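/- **Theorem 4.5.** In the Euclidean plane let $z_0=(0,0)$, $z_1=(1,0)$, $z_2=(\tfrac12,\tfrac{\sqrt3}{2})$, let $f_i(x)=\tfrac12x+\tfrac12z_i$ for $i=0,1,2$, and let $s=\frac{\log 3}{\log 2}$, the similarity dimension of the Sierpinski gasket (the attractor of $\{f_0,f_1,f_2\}$). Let $\mu$ be the natural probability measure of the gasket, that is, the unique compactly supported Borel probability measure on $\mathbb R^2$ with $\mu=\mathbf M(\mu)$, where $\mathbf M(\alpha)=\frac13\sum_{i=0}^2\alpha\circ f_i^{-1}$. Put $A_1=\{z_0,z_1,z_2\}$, $\mu_1=\frac13(\delta_{z_0}+\delta_{z_1}+\delta_{z_2})$ and, for $k\ge2$, $A_k=F^{k-1}(A_1)$, where $F(A)=f_0(A)\cup f_1(A)\cup f_2(A)$, and $\mu_k=\mathbf M^{k-1}(\mu_1)$. Let $B(x,d)$ and $\mathring B(x,d)$ be the closed and the open Euclidean ball with centre $x$ and radius $d$. For a Borel measure $\alpha$ and $d>0$ let $$\theta^s_\alpha(x,d)=\frac{\alpha(B(x,d))}{(2d)^s},\qquad \mathring\theta^s_\alpha(x,d)=\frac{\alpha(\mathring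 B(x,d))}{(2d)^s},\qquad \underline\theta^s_\alpha(x)=\liminf_{d\to0^+}\theta^s_\alpha(x,d),\qquad \overline\theta^s_\alpha(x)=\limsup_{d\to0^+}\theta^s_\alpha(x,d).$$ For an integer $k>1$ let $R_k=\{|x-z_0| : x\in A_k\}\cap[\tfrac12-2^{-k},1]$ and $$\underline\xi_k=\min_{d\in R_k}\mathring\theta^s_{\mu_k}(z_0,d),\qquad \overline\xi_k=\max_{d\in R_k}\theta^s_{\mu_k}(z_0,d);$$ both extrema are attained. Let $d_k\in R_k$ be any radius with $\mathring\theta^s_{\mu_k}(z_0,d_k)=\underline\xi_k$ and let $D_k\in R_k$ be any radius with $\theta^s_{\mu_k}(z_0,D_k)=\overline\xi_k$. Then both $\underline\theta^s_\mu(z_0)$ and $\underline\xi_k$ lie in $$\left[(1-2^{1-k})^s\,\underline\xi_k,\ \frac{\mu_k(\mathring B(z_0,d_k+2^{-k}))}{(2d_k)^s}\right],$$ and both $\overline\theta^s_\mu(z_0)$ and $\overline\xi_k$ lie in $$\left[\frac{\mu_k(B(z_0,D_k-2^{-k}))}{(2D_k)^s},\ (1+2^{1-k})^s\,\overline\xi_k\right].$$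 -/

import Mathlib

open MeasureTheory Filter Topology
open scoped ENNReal

namespace SierpinskiGasket

/-- The Euclidean plane. -/
abbrev Plane : Type := EuclideanSpace ℝ (Fin 2)

/-- The vertices `z₀ = (0,0)`, `z₁ = (1,0)`, `z₂ = (1/2, √3/2)`. -/
noncomputable def vertex : Fin 3 → Plane :=
  ![!₂[0, 0], !₂[1, 0], !₂[1 / 2, Real.sqrt 3 / 2]]

/-- The similitudes `f₀, f₁, f₂` of ratio `1/2`; `sim i` has fixed point `vertex i`. -/
noncomputable def sim (i : Fin 3) (x : Plane) : Plane :=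
  (1 / 2 : ℝ) • x + (1 / 2 : ℝ) • vertex i

/-- The similarity dimension `s = log 3 / log 2` of the gasket. -/
noncomputable def simDim : ℝ := Real.log 3 / Real.log 2

/-- The Hutchinson operator `F(A) = f₀(A) ∪ f₁(A) ∪ f₂(A)`. -/
def hutchinson (A : Set Plane) : Set Plane := ⋃ i : Fin 3, sim i '' A

/-- The discrete sets `A₁ = {z₀, z₁, z₂}` and `A_k = F^{k-1}(A₁)`, for `k ≥ 1`. -/
def approxSet (k : ℕ) : Set Plane := hutchinson^[k - 1] (Set.range vertex)

/-- The Markov operator `M(α) = ∑ i, r_i^s • (α ∘ f_i⁻¹)`, with `r_i^s = (1/2)^s = 1/3`. -/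
noncomputable def markov (α : Measure Plane) : Measure Plane :=
  ∑ i : Fin 3, (3 : ℝ≥0∞)⁻¹ • α.map (sim i)

/-- The discrete measures `μ₁ = (δ_{z₀} + δ_{z₁} + δ_{z₂}) / 3` and `μ_k = M^{k-1}(μ₁)`,
for `k ≥ 1`. -/
noncomputable def discreteMeasure (k : ℕ) : Measure Plane :=
  markov^[k - 1] ((3 : ℝ≥0∞)⁻¹ • ∑ i : Fin 3, Measure.dirac (vertex i))

/-- `α` is a compactly supported Borel probability measure on the plane that is fixed by the
Markov operator. -/
structure IsInvariant (α : Measure Plane) : Prop where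
  isProbabilityMeasure : IsProbabilityMeasure α
  compactSupport : ∃ K : Set Plane, IsCompact K ∧ α Kᶜ = 0
  markov_eq : markov α = α

/-! The Markov operator has exactly one invariant measure. -/

theorem continuous_sim (i : Fin 3) : Continuous (sim i) := by
  unfold sim; fun_prop

theorem charFun_markov (α : Measure Plane) [IsProbabilityMeasure α] (t : Plane) :
    charFun (markov α) t =
      ∑ i : Fin 3, (3 : ℂ)⁻¹ *
        (charFun α ((1 / 2 : ℝ) • t) *
          Complex.exp (inner ℝ ((1 / 2 : ℝ) • vertex i) t * Complex.I)) := by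
  have hint : ∀ i : Fin 3, charFun (α.map (sim i)) t = charFun α ((1 / 2 : ℝ) • t) *
      Complex.exp (inner ℝ ((1 / 2 : ℝ) • vertex i) t * Complex.I) := by
    intro i
    have h : α.map (sim i)
        = (α.map (fun x => (1 / 2 : ℝ) • x)).map (fun x => x + (1 / 2 : ℝ) • vertex i) := by
      rw [Measure.map_map (by fun_prop) (by fun_prop)]; rfl
    rw [h, charFun_map_add_const, charFun_map_smul]
  simp only [← hint]
  simp only [charFun_apply, markov]
  rw [integral_finsetSum_measure]
  · refine Finset.sum_congr rfl fun i _ => ?_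
    rw [integral_smul_measure]
    simp [Complex.real_smul]
  · intro i _
    have : IsProbabilityMeasure (α.map (sim i)) :=
      Measure.isProbabilityMeasure_map (continuous_sim i).measurable.aemeasurable
    refine Integrable.smul_measure ?_ (by simp)
    refine Integrable.of_bound (C := 1) (by fun_prop) (ae_of_all _ fun x => ?_)
    rw [Complex.norm_exp_ofReal_mul_I]

theorem invariant_unique {α β : Measure Plane} (hα : IsInvariant α) (hβ : IsInvariant β) :
    α = β := by
  have := hα.isProbabilityMeasure
  have := hβ.isProbabilityMeasure
  refine Measure.ext_of_charFun (funext fun t => ?_)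
  have step : ∀ t : Plane, ‖charFun α t - charFun β t‖
      ≤ ‖charFun α ((1 / 2 : ℝ) • t) - charFun β ((1 / 2 : ℝ) • t)‖ := by
    intro t
    conv_lhs => rw [← hα.markov_eq, ← hβ.markov_eq]
    rw [charFun_markov, charFun_markov, ← Finset.sum_sub_distrib]
    refine (norm_sum_le _ _).trans ?_
    simp only [← mul_sub, ← sub_mul, norm_mul, Complex.norm_exp_ofReal_mul_I]
    simp
  have iter : ∀ n : ℕ, ‖charFun α t - charFun β t‖
      ≤ ‖charFun α ((1 / 2 : ℝ) ^ n • t) - charFun β ((1 / 2 : ℝ) ^ n • t)‖ := by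
    intro n
    induction n with
    | zero => simp
    | succ n ih =>
      refine ih.trans ((step _).trans (le_of_eq ?_))
      rw [smul_smul, pow_succ']
  have lim : Tendsto (fun n : ℕ => (1 / 2 : ℝ) ^ n • t) atTop (𝓝 0) := by
    have := (tendsto_pow_atTop_nhds_zero_of_lt_one (r := (1 / 2 : ℝ))
      (by norm_num) (by norm_num)).smul_const t
    simpa using this
  have cα : Continuous (charFun α) := continuous_charFun
  have cβ : Continuous (charFun β) := continuous_charFun
  have lim2 := (((cα.tendsto 0).comp lim).sub ((cβ.tendsto 0).comp lim)).norm
  have h0 := ge_of_tendsto' lim2 iter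
  rw [charFun_zero, charFun_zero] at h0
  simp at h0
  exact sub_eq_zero.mp h0

/-- The uniform measure on the alphabet. -/
noncomputable def letterMeasure : Measure (Fin 3) := ∑ i : Fin 3, (3 : ℝ≥0∞)⁻¹ • Measure.dirac i

instance : IsProbabilityMeasure letterMeasure where
  measure_univ := by
    simp only [letterMeasure, Measure.finsetSum_apply, Measure.smul_apply, measure_univ]
    simp [ENNReal.mul_inv_cancel]

/-- The uniform Bernoulli measure on the code space. -/
noncomputable def codeMeasure : Measure (ℕ → Fin 3) := Measure.infinitePi fun _ => letterMeasure

instance : IsProbabilityMeasure codeMeasure := by unfold codeMeasure; infer_instance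

/-- The word `i w₀ w₁ …`. -/
def cons (i : Fin 3) (w : ℕ → Fin 3) : ℕ → Fin 3 := fun n => Nat.casesOn n i w

theorem measurable_cons (i : Fin 3) : Measurable (cons i) := by
  refine measurable_pi_lambda _ fun n => ?_
  cases n with
  | zero => exact measurable_const
  | succ n => exact measurable_pi_apply n

theorem codeMeasure_eq : ∑ i : Fin 3, (3 : ℝ≥0∞)⁻¹ • codeMeasure.map (cons i) = codeMeasure := by
  classical
  refine Measure.eq_infinitePi _ fun S t ht => ?_
  obtain ⟨N, hN⟩ : ∃ N : ℕ, ∀ n ∈ S, n < N + 1 :=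
    ⟨S.sup id, fun n hn => Nat.lt_succ_of_le (Finset.le_sup (f := id) hn)⟩
  set t' : ℕ → Set (Fin 3) := fun n => if n ∈ S then t n else Set.univ with ht'
  have hbox : Set.pi (S : Set ℕ) t = Set.pi (Finset.range (N + 1) : Set ℕ) t' := by
    ext w
    simp only [Set.mem_pi, ht', Finset.mem_coe, Finset.mem_range]
    constructor
    · intro h n _
      by_cases hn : n ∈ S
      · simpa [hn] using h n hn
      · simp [hn]
    · intro h n hn
      simpa [hn] using h n (hN n hn)
  have hprod : ∏ n ∈ S, letterMeasure (t n)
      = ∏ n ∈ Finset.range (N + 1), letterMeasure (t' n) := by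
    rw [← Finset.prod_subset (s₁ := S) (fun n hn => Finset.mem_range.2 (hN n hn))]
    · exact Finset.prod_congr rfl fun n hn => by simp [ht', hn]
    · intro n _ hn
      simp [ht', hn]
  have hmeas : MeasurableSet (Set.pi (Finset.range (N + 1) : Set ℕ) t') :=
    MeasurableSet.pi (Set.to_countable _) fun n _ => MeasurableSet.of_discrete
  rw [hbox, hprod, Finset.prod_range_succ']
  have hpre : ∀ i : Fin 3, codeMeasure (cons i ⁻¹' Set.pi (Finset.range (N + 1) : Set ℕ) t')
      = (t' 0).indicator 1 i * ∏ n ∈ Finset.range N, letterMeasure (t' (n + 1)) := by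
    intro i
    by_cases hi : i ∈ t' 0
    · have : cons i ⁻¹' Set.pi (Finset.range (N + 1) : Set ℕ) t'
          = Set.pi (Finset.range N : Set ℕ) fun n => t' (n + 1) := by
        ext w
        simp only [Set.mem_preimage, Set.mem_pi, Finset.mem_coe, Finset.mem_range]
        constructor
        · intro h n hn
          exact h (n + 1) (by omega)
        · intro h n hn
          cases n with
          | zero => exact hi
          | succ n => exact h n (by omega)
      rw [this, codeMeasure, Measure.infinitePi_pi _ fun n _ => MeasurableSet.of_discrete]
      simp [hi]
    · have : cons i ⁻¹' Set.pi (Finset.range (N + 1) : Set ℕ) t' = ∅ := by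
        ext w
        simp only [Set.mem_preimage, Set.mem_pi, Finset.mem_coe, Finset.mem_range,
          Set.mem_empty_iff_false, iff_false]
        exact fun h => hi (h 0 (by omega))
      rw [this]
      simp [hi]
  simp only [Measure.finsetSum_apply, Measure.smul_apply,
    Measure.map_apply (measurable_cons _) hmeas, hpre, smul_eq_mul]
  rw [mul_comm (∏ n ∈ Finset.range N, letterMeasure (t' (n + 1)))]
  generalize (∏ n ∈ Finset.range N, letterMeasure (t' (n + 1))) = c
  simp only [letterMeasure, Measure.finsetSum_apply, Measure.smul_apply, smul_eq_mul,
    Finset.sum_mul, Measure.dirac_apply, mul_assoc]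

theorem norm_vertex_le (i : Fin 3) : ‖vertex i‖ ≤ 1 := by
  have h3 : (Real.sqrt 3) ^ 2 = 3 := Real.sq_sqrt (by norm_num)
  fin_cases i <;> simp [vertex, EuclideanSpace.norm_eq, Fin.sum_univ_two, div_pow]
  norm_num

/-- The coding map of the gasket. -/
noncomputable def code (w : ℕ → Fin 3) : Plane := ∑' n : ℕ, ((1 / 2 : ℝ) ^ (n + 1)) • vertex (w n)

theorem norm_term_le (n : ℕ) (w : ℕ → Fin 3) :
    ‖((1 / 2 : ℝ) ^ (n + 1)) • vertex (w n)‖ ≤ (1 / 2 : ℝ) / 2 ^ n := by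
  rw [norm_smul, Real.norm_of_nonneg (by positivity)]
  calc (1 / 2 : ℝ) ^ (n + 1) * ‖vertex (w n)‖ ≤ (1 / 2 : ℝ) ^ (n + 1) * 1 := by
        gcongr; exact norm_vertex_le _
    _ = (1 / 2 : ℝ) / 2 ^ n := by rw [pow_succ]; simp; ring

theorem summable_bound : Summable fun n : ℕ => (1 / 2 : ℝ) / 2 ^ n := by
  have := summable_geometric_two' (1 : ℝ)
  exact this

theorem continuous_code : Continuous code := by
  refine continuous_tsum (fun n => ?_) summable_bound norm_term_le
  have hz : Continuous vertex := continuous_of_discreteTopology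
  have hw : Continuous fun w : ℕ → Fin 3 => w n := continuous_apply n
  exact (hz.comp hw).const_smul ((1 / 2 : ℝ) ^ (n + 1))

theorem code_cons (i : Fin 3) (w : ℕ → Fin 3) : code (cons i w) = sim i (code w) := by
  have h : ∀ w : ℕ → Fin 3, Summable fun n : ℕ => ((1 / 2 : ℝ) ^ (n + 1)) • vertex (w n) := fun w =>
    Summable.of_norm_bounded summable_bound fun n => norm_term_le n w
  unfold code sim
  rw [(h _).tsum_eq_zero_add, add_comm, ← (h w).tsum_const_smul]
  congr 1
  · refine tsum_congr fun n => ?_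
    rw [smul_smul, ← pow_succ']
    rfl
  · simp [cons]

theorem isInvariant_map_code : IsInvariant (codeMeasure.map code) where
  isProbabilityMeasure :=
    Measure.isProbabilityMeasure_map continuous_code.measurable.aemeasurable
  compactSupport := by
    have hK : IsCompact (Set.range code) := isCompact_range continuous_code
    refine ⟨Set.range code, hK, ?_⟩
    rw [Measure.map_apply continuous_code.measurable hK.measurableSet.compl]
    simp
  markov_eq := by
    have hc : Measurable code := continuous_code.measurable
    conv_rhs => rw [← codeMeasure_eq]
    rw [markov, Measure.map_finset_sum hc.aemeasurable]
    refine Finset.sum_congr rfl fun i _ => ?_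
    rw [Measure.map_smul, Measure.map_map (continuous_sim i).measurable hc,
      Measure.map_map hc (measurable_cons i)]
    congr 2
    exact funext fun w => (code_cons i w).symm

theorem existsUnique_isInvariant : ∃! α : Measure Plane, IsInvariant α :=
  ⟨_, isInvariant_map_code, fun _ hβ => invariant_unique hβ isInvariant_map_code⟩

/-- The natural probability measure `μ` of the gasket: the unique compactly supported Borel
probability measure that is fixed by the Markov operator. -/
noncomputable def naturalMeasure : Measure Plane := existsUnique_isInvariant.choose

/-- The `t`-density `α(B(x,d)) / (2d)^t` of the closed ball `B(x,d)`, for `d > 0`. -/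
noncomputable def density (α : Measure Plane) (t : ℝ) (x : Plane) (d : ℝ) : ℝ≥0∞ :=
  α (Metric.closedBall x d) / ENNReal.ofReal ((2 * d) ^ t)

/-- The `t`-density of the open ball of centre `x` and radius `d`, for `d > 0`. -/
noncomputable def openDensity (α : Measure Plane) (t : ℝ) (x : Plane) (d : ℝ) : ℝ≥0∞ :=
  α (Metric.ball x d) / ENNReal.ofReal ((2 * d) ^ t)

/-- The lower spherical `t`-density of `α` at `x`. -/
noncomputable def lowerDensity (α : Measure Plane) (t : ℝ) (x : Plane) : ℝ≥0∞ :=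
  liminf (fun d : ℝ => density α t x d) (𝓝[>] 0)

/-- The upper spherical `t`-density of `α` at `x`. -/
noncomputable def upperDensity (α : Measure Plane) (t : ℝ) (x : Plane) : ℝ≥0∞ :=
  limsup (fun d : ℝ => density α t x d) (𝓝[>] 0)

/-- The radii `d = |x - z₀|` with `x ∈ A_k` and `d ∈ [1/2 - 2^{-k}, 1]`. -/
def radii (k : ℕ) : Set ℝ :=
  {d | (∃ x ∈ approxSet k, d = dist x (vertex 0)) ∧ d ∈ Set.Icc (1 / 2 - (2 : ℝ) ^ (-(k : ℤ))) 1}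

/-- The smallest `μ_k`-density of an open ball centred at `z₀` with radius in `radii k`. -/
noncomputable def lowerEstimate (k : ℕ) : ℝ≥0∞ :=
  sInf (openDensity (discreteMeasure k) simDim (vertex 0) '' radii k)

/-- The largest `μ_k`-density of a closed ball centred at `z₀` with radius in `radii k`. -/
noncomputable def upperEstimate (k : ℕ) : ℝ≥0∞ :=
  sSup (density (discreteMeasure k) simDim (vertex 0) '' radii k)

end SierpinskiGasket

open SierpinskiGasket

namespace SierpinskiGasket

/-! Two facts carry the proof. The first is a coupling: `μ` and `μ_k` are the laws of `code` and
`approxCode (k - 1)` under the same Bernoulli measure, and these two points never differ by more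
than `2^{-k}` (`dist_code_approxCode_le`). Balls of one measure are thus compared with balls of the
other at the price of `2^{-k}` in the radius.

The second is scaling at `z₀`. Since `2^s = 3`, the cell `f₀(K)` contributes to the density at `r`
exactly the density at `2r`. Hence doubling never increases the density (`density_two_mul_le`), and
it preserves it for `r < 1/2`, where the other cells are out of reach (`density_two_mul_eq`). Every
density at a positive radius is therefore at most the upper density, those at radii below `1` are at
least the lower one, and bounds on `[1/2, 1)` suffice for the reverse estimates.

On `[1/2, 1)` the coupling replaces `d` by `d ∓ 2^{-k}`, and finiteness of `A_k` moves this to a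
radius in `radii k`. As `d ≥ 1/2`, the shift costs at most a factor `1 ∓ 2^{1-k}` in the radius. -/

/-! ### Geometry of the vertices and of the coding map -/

theorem vertex_zero : vertex 0 = 0 := by
  ext i
  fin_cases i <;> simp [vertex]

theorem norm_vertex_sub_le (i j : Fin 3) : ‖vertex i - vertex j‖ ≤ 1 := by
  have h3 : (Real.sqrt 3) ^ 2 = 3 := Real.sq_sqrt (by norm_num)
  rw [EuclideanSpace.norm_eq, Real.sqrt_le_one, Fin.sum_univ_two]
  fin_cases i <;> fin_cases j <;> simp [vertex, div_pow] <;> norm_num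

theorem norm_vertex_of_ne_zero {i : Fin 3} (hi : i ≠ 0) : ‖vertex i‖ = 1 := by
  have h3 : (Real.sqrt 3) ^ 2 = 3 := Real.sq_sqrt (by norm_num)
  fin_cases i
  · simp at hi
  · simp [vertex, EuclideanSpace.norm_eq]
  · simp [vertex, EuclideanSpace.norm_eq, div_pow]
    norm_num

theorem inner_vertex_nonneg (i j : Fin 3) : 0 ≤ inner ℝ (vertex i) (vertex j) := by
  have h3 : 0 ≤ Real.sqrt 3 := Real.sqrt_nonneg 3
  rw [PiLp.inner_apply, Fin.sum_univ_two]
  fin_cases i <;> fin_cases j <;> (simp [vertex]; try positivity)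

theorem summable_code (w : ℕ → Fin 3) :
    Summable fun n : ℕ => ((1 / 2 : ℝ) ^ (n + 1)) • vertex (w n) :=
  Summable.of_norm_bounded summable_bound fun n => norm_term_le n w

theorem cons_shift (w : ℕ → Fin 3) : cons (w 0) (fun n => w (n + 1)) = w := by
  funext n
  cases n <;> rfl

theorem code_eq_sim (w : ℕ → Fin 3) : code w = sim (w 0) (code fun n => w (n + 1)) := by
  rw [← code_cons, cons_shift]

theorem code_const (i : Fin 3) : code (fun _ => i) = vertex i := by
  have h := code_eq_sim fun _ => i
  unfold sim at h
  have h2 : (1 / 2 : ℝ) • code (fun _ => i) = (1 / 2 : ℝ) • vertex i := by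
    conv_lhs => rw [show (1 / 2 : ℝ) = 1 - 1 / 2 by norm_num, sub_smul, one_smul]
    exact sub_eq_iff_eq_add'.2 h
  exact smul_right_injective Plane (by norm_num : (1 / 2 : ℝ) ≠ 0) h2

/-- A vertex is the code of a constant word, so the two series compare termwise, with weights
`2^{-(n+1)}` of sum `1`. -/
theorem norm_code_sub_vertex_le (w : ℕ → Fin 3) (i : Fin 3) : ‖code w - vertex i‖ ≤ 1 := by
  rw [← code_const i, code, code, ← (summable_code w).tsum_sub (summable_code _)]
  refine tsum_of_norm_bounded (hasSum_geometric_two' 1) fun n => ?_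
  rw [← smul_sub, norm_smul, Real.norm_of_nonneg (by positivity)]
  calc (1 / 2 : ℝ) ^ (n + 1) * ‖vertex (w n) - vertex i‖ ≤ (1 / 2 : ℝ) ^ (n + 1) * 1 := by
        gcongr; exact norm_vertex_sub_le _ _
    _ = 1 / 2 / 2 ^ n := by rw [pow_succ]; simp; ring

theorem inner_code_vertex_nonneg (w : ℕ → Fin 3) (i : Fin 3) :
    0 ≤ inner ℝ (vertex i) (code w) := by
  have h := (summable_code w).hasSum.mapL (innerSL ℝ (vertex i))
  refine h.nonneg fun n => ?_
  simp only [innerSL_apply_apply, inner_smul_right]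
  exact mul_nonneg (by positivity) (inner_vertex_nonneg _ _)

/-- The cells `f₁(K)` and `f₂(K)` stay at distance at least `1/2` from `z₀`. -/
theorem half_le_norm_sim_code {i : Fin 3} (hi : i ≠ 0) (w : ℕ → Fin 3) :
    1 / 2 ≤ ‖sim i (code w)‖ := by
  -- Project onto the unit vector `vertex i`: the translation part contributes `1/2`, and the rest
  -- is nonnegative because the gasket lies in an acute sector at `z₀`.
  have h := real_inner_le_norm (vertex i) (sim i (code w))
  rw [norm_vertex_of_ne_zero hi, one_mul, sim, inner_add_right, inner_smul_right,
    inner_smul_right, real_inner_self_eq_norm_sq, norm_vertex_of_ne_zero hi] at h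
  have := inner_code_vertex_nonneg w i
  rw [sim]
  linarith

/-! ### Coupling of the natural and the discrete measures on the code space -/

/-- The point `f_{w₀} ∘ ⋯ ∘ f_{w_{n-1}} (z_{w_n})`. -/
noncomputable def approxCode : ℕ → (ℕ → Fin 3) → Plane
  | 0, w => vertex (w 0)
  | n + 1, w => sim (w 0) (approxCode n fun m => w (m + 1))

theorem measurable_approxCode (n : ℕ) : Measurable (approxCode n) := by
  have hv : Measurable vertex := measurable_of_finite _
  induction n with
  | zero => exact hv.comp (measurable_pi_apply 0)
  | succ n ih =>
    have h1 : Measurable fun w : ℕ → Fin 3 => approxCode n fun m => w (m + 1) :=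
      ih.comp (measurable_pi_lambda _ fun m => measurable_pi_apply (m + 1))
    have h2 : Measurable fun w : ℕ → Fin 3 => vertex (w 0) := hv.comp (measurable_pi_apply 0)
    exact (h1.const_smul (1 / 2 : ℝ)).add (h2.const_smul (1 / 2 : ℝ))

/-- Conditioning on the first letter, which is uniform and independent of the shifted word. -/
theorem map_codeMeasure_eq {f : (ℕ → Fin 3) → Plane} (hf : Measurable f) :
    codeMeasure.map f = ∑ i : Fin 3, (3 : ℝ≥0∞)⁻¹ • codeMeasure.map fun w => f (cons i w) := by
  conv_lhs => rw [← codeMeasure_eq]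
  rw [Measure.map_finset_sum hf.aemeasurable]
  refine Finset.sum_congr rfl fun i _ => ?_
  rw [Measure.map_smul, Measure.map_map hf (measurable_cons i)]
  rfl

theorem iterate_markov_eq_map (n : ℕ) :
    markov^[n] ((3 : ℝ≥0∞)⁻¹ • ∑ i : Fin 3, Measure.dirac (vertex i))
      = codeMeasure.map (approxCode n) := by
  induction n with
  | zero =>
    rw [map_codeMeasure_eq (measurable_approxCode 0), Function.iterate_zero, id,
      Finset.smul_sum]
    refine Finset.sum_congr rfl fun i _ => ?_
    have : (fun w => approxCode 0 (cons i w)) = fun _ => vertex i := rfl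
    rw [this, Measure.map_const, measure_univ, one_smul]
  | succ n ih =>
    rw [Function.iterate_succ_apply', ih, map_codeMeasure_eq (measurable_approxCode (n + 1)),
      markov]
    refine Finset.sum_congr rfl fun i _ => ?_
    rw [Measure.map_map (continuous_sim i).measurable (measurable_approxCode n)]
    rfl

theorem norm_code_sub_approxCode_le (n : ℕ) (w : ℕ → Fin 3) :
    ‖code w - approxCode n w‖ ≤ (1 / 2 : ℝ) ^ (n + 1) := by
  induction n generalizing w with
  | zero =>
    -- Since `vertex (w 0)` is fixed by `sim (w 0)`, both points lie in the same first-level cell;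
    -- this gives the extra factor `1/2`.
    have h : code w - approxCode 0 w
        = (1 / 2 : ℝ) • (code (fun n => w (n + 1)) - vertex (w 0)) := by
      rw [code_eq_sim w, approxCode, sim]
      module
    rw [h, norm_smul, Real.norm_of_nonneg (by norm_num)]
    have := norm_code_sub_vertex_le (fun n => w (n + 1)) (w 0)
    norm_num
    linarith
  | succ n ih =>
    have h : code w - approxCode (n + 1) w
        = (1 / 2 : ℝ) • (code (fun n => w (n + 1)) - approxCode n fun n => w (n + 1)) := by
      rw [code_eq_sim w, approxCode, sim, sim]
      module
    rw [h, norm_smul, Real.norm_of_nonneg (by norm_num), pow_succ' _ (n + 1)]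
    gcongr
    exact ih _

theorem naturalMeasure_eq_map : naturalMeasure = codeMeasure.map code :=
  invariant_unique existsUnique_isInvariant.choose_spec.1 isInvariant_map_code

theorem naturalMeasure_apply {S : Set Plane} (hS : MeasurableSet S) :
    naturalMeasure S = codeMeasure (code ⁻¹' S) := by
  rw [naturalMeasure_eq_map, Measure.map_apply continuous_code.measurable hS]

theorem discreteMeasure_apply (k : ℕ) {S : Set Plane} (hS : MeasurableSet S) :
    discreteMeasure k S = codeMeasure (approxCode (k - 1) ⁻¹' S) := by
  rw [discreteMeasure, iterate_markov_eq_map, Measure.map_apply (measurable_approxCode _) hS]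

theorem dist_code_approxCode_le {k : ℕ} (hk : 1 ≤ k) (w : ℕ → Fin 3) :
    dist (code w) (approxCode (k - 1) w) ≤ (2 : ℝ) ^ (-(k : ℤ)) := by
  have h := norm_code_sub_approxCode_le (k - 1) w
  rw [Nat.sub_add_cancel hk] at h
  rw [dist_eq_norm, zpow_neg, zpow_natCast]
  simpa using h

/-! ### Comparison of the natural and the discrete measures -/

theorem naturalMeasure_closedBall_le {k : ℕ} (hk : 1 ≤ k) (x : Plane) (r : ℝ) :
    naturalMeasure (Metric.closedBall x r)
      ≤ discreteMeasure k (Metric.closedBall x (r + (2 : ℝ) ^ (-(k : ℤ)))) := by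
  rw [naturalMeasure_apply measurableSet_closedBall,
    discreteMeasure_apply k measurableSet_closedBall]
  refine measure_mono fun w hw => ?_
  simp only [Set.mem_preimage, Metric.mem_closedBall] at hw ⊢
  have := dist_triangle_left (approxCode (k - 1) w) x (code w)
  have := dist_code_approxCode_le hk w
  linarith

theorem naturalMeasure_ball_le {k : ℕ} (hk : 1 ≤ k) (x : Plane) (r : ℝ) :
    naturalMeasure (Metric.ball x r)
      ≤ discreteMeasure k (Metric.ball x (r + (2 : ℝ) ^ (-(k : ℤ)))) := by
  rw [naturalMeasure_apply measurableSet_ball, discreteMeasure_apply k measurableSet_ball]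
  refine measure_mono fun w hw => ?_
  simp only [Set.mem_preimage, Metric.mem_ball] at hw ⊢
  have := dist_triangle_left (approxCode (k - 1) w) x (code w)
  have := dist_code_approxCode_le hk w
  linarith

theorem discreteMeasure_closedBall_sub_le {k : ℕ} (hk : 1 ≤ k) (x : Plane) (r : ℝ) :
    discreteMeasure k (Metric.closedBall x (r - (2 : ℝ) ^ (-(k : ℤ))))
      ≤ naturalMeasure (Metric.closedBall x r) := by
  rw [naturalMeasure_apply measurableSet_closedBall,
    discreteMeasure_apply k measurableSet_closedBall]
  refine measure_mono fun w hw => ?_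
  simp only [Set.mem_preimage, Metric.mem_closedBall] at hw ⊢
  have := dist_triangle (code w) (approxCode (k - 1) w) x
  have := dist_code_approxCode_le hk w
  linarith

/-! ### The discrete sets -/

theorem sim_vertex_self (i : Fin 3) : sim i (vertex i) = vertex i := by
  unfold sim
  module

theorem finite_iterate_hutchinson (n : ℕ) : (hutchinson^[n] (Set.range vertex)).Finite := by
  induction n with
  | zero => exact Set.finite_range _
  | succ n ih =>
    rw [Function.iterate_succ_apply']
    exact Set.finite_iUnion fun i => ih.image _

theorem vertex_mem_iterate_hutchinson (n : ℕ) (i : Fin 3) :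
    vertex i ∈ hutchinson^[n] (Set.range vertex) := by
  induction n with
  | zero => exact ⟨i, rfl⟩
  | succ n ih =>
    rw [Function.iterate_succ_apply']
    exact Set.mem_iUnion.2 ⟨i, vertex i, ih, sim_vertex_self i⟩

theorem norm_le_one_of_mem_iterate_hutchinson (n : ℕ) :
    ∀ x ∈ hutchinson^[n] (Set.range vertex), ‖x‖ ≤ 1 := by
  induction n with
  | zero => rintro x ⟨i, rfl⟩; exact norm_vertex_le i
  | succ n ih =>
    rw [Function.iterate_succ_apply']
    intro x hx
    obtain ⟨i, y, hy, rfl⟩ := Set.mem_iUnion.1 hx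
    refine (norm_add_le _ _).trans ?_
    rw [norm_smul, norm_smul, Real.norm_of_nonneg (by norm_num)]
    linarith [ih y hy, norm_vertex_le i]

theorem approxCode_mem (n : ℕ) (w : ℕ → Fin 3) :
    approxCode n w ∈ hutchinson^[n] (Set.range vertex) := by
  induction n generalizing w with
  | zero => exact ⟨w 0, rfl⟩
  | succ n ih =>
    rw [Function.iterate_succ_apply']
    exact Set.mem_iUnion.2 ⟨w 0, _, ih _, rfl⟩

theorem half_mem_dist_approxSet {k : ℕ} (hk : 1 < k) :
    ∃ x ∈ approxSet k, dist x (vertex 0) = 1 / 2 := by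
  refine ⟨sim 0 (vertex 1), ?_, ?_⟩
  · obtain ⟨n, rfl⟩ : ∃ n, k = n + 2 := ⟨k - 2, by omega⟩
    rw [approxSet, show n + 2 - 1 = n + 1 by omega, Function.iterate_succ_apply']
    exact Set.mem_iUnion.2 ⟨0, _, vertex_mem_iterate_hutchinson n 1, rfl⟩
  · rw [vertex_zero, dist_zero_right, sim, vertex_zero, smul_zero, add_zero, norm_smul,
      norm_vertex_of_ne_zero (by decide)]
    norm_num

theorem finite_radii (k : ℕ) : (radii k).Finite := by
  refine ((finite_iterate_hutchinson (k - 1)).image fun x => dist x (vertex 0)).subset ?_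
  rintro d ⟨⟨x, hx, rfl⟩, -⟩
  exact ⟨x, hx, rfl⟩

theorem two_zpow_neg_le {k : ℕ} (hk : 1 < k) : (2 : ℝ) ^ (-(k : ℤ)) ≤ 1 / 4 := by
  calc (2 : ℝ) ^ (-(k : ℤ)) ≤ (2 : ℝ) ^ (-2 : ℤ) :=
        zpow_le_zpow_right₀ (by norm_num) (by omega)
    _ = 1 / 4 := by norm_num

theorem two_zpow_one_sub (k : ℕ) : (2 : ℝ) ^ (1 - (k : ℤ)) = 2 * (2 : ℝ) ^ (-(k : ℤ)) := by
  rw [sub_eq_add_neg, zpow_add₀ (by norm_num), zpow_one]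

theorem nonempty_radii {k : ℕ} (hk : 1 < k) : (radii k).Nonempty := by
  obtain ⟨x, hx, hd⟩ := half_mem_dist_approxSet hk
  refine ⟨1 / 2, ⟨x, hx, hd.symm⟩, ?_, by norm_num⟩
  have : (0 : ℝ) < (2 : ℝ) ^ (-(k : ℤ)) := by positivity
  linarith

theorem radii_pos {k : ℕ} (hk : 1 < k) {d : ℝ} (hd : d ∈ radii k) : 0 < d := by
  have := hd.2.1
  have := two_zpow_neg_le hk
  linarith

/-- The next radius after `r`: the closed ball of radius `r` has the mass of an open ball. -/
theorem exists_radius_ball_le {k : ℕ} {r : ℝ} (h0 : 1 / 2 - (2 : ℝ) ^ (-(k : ℤ)) ≤ r)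
    (h1 : r < 1) :
    ∃ d ∈ radii k, r < d ∧ discreteMeasure k (Metric.ball (vertex 0) d)
      ≤ discreteMeasure k (Metric.closedBall (vertex 0) r) := by
  set S : Set ℝ := {d | r < d ∧ ∃ x ∈ approxSet k, d = dist x (vertex 0)}
  have hS : S.Finite := by
    refine ((finite_iterate_hutchinson (k - 1)).image fun x => dist x (vertex 0)).subset ?_
    rintro d ⟨-, x, hx, rfl⟩
    exact ⟨x, hx, rfl⟩
  have hne : S.Nonempty := by
    -- `z₁` belongs to every `A_k` and has distance `1` from `z₀`, so a next radius exists.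
    refine ⟨1, h1, vertex 1, vertex_mem_iterate_hutchinson _ 1, ?_⟩
    rw [vertex_zero, dist_zero_right, norm_vertex_of_ne_zero (by decide)]
  obtain ⟨d, ⟨hrd, x, hx, hd⟩, hmin⟩ := Set.exists_min_image S id hS hne
  refine ⟨d, ⟨⟨x, hx, hd⟩, by linarith, ?_⟩, hrd, ?_⟩
  · rw [hd, vertex_zero, dist_zero_right]
    exact norm_le_one_of_mem_iterate_hutchinson _ x hx
  · rw [discreteMeasure_apply k measurableSet_ball,
      discreteMeasure_apply k measurableSet_closedBall]
    refine measure_mono fun w hw => ?_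
    simp only [Set.mem_preimage, Metric.mem_ball, Metric.mem_closedBall] at hw ⊢
    by_contra! hcon
    exact absurd hw (not_lt.2 (hmin _ ⟨hcon, _, approxCode_mem _ w, rfl⟩))

/-- The last radius up to `r` carries the mass of the closed ball of radius `r`. -/
theorem exists_radius_closedBall_le {k : ℕ} (hk : 1 < k) {r : ℝ} (hr : 1 / 2 ≤ r) :
    ∃ d ∈ radii k, d ≤ r ∧ discreteMeasure k (Metric.closedBall (vertex 0) r)
      ≤ discreteMeasure k (Metric.closedBall (vertex 0) d) := by
  set S : Set ℝ := {d | d ≤ r ∧ ∃ x ∈ approxSet k, d = dist x (vertex 0)}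
  have hS : S.Finite := by
    refine ((finite_iterate_hutchinson (k - 1)).image fun x => dist x (vertex 0)).subset ?_
    rintro d ⟨-, x, hx, rfl⟩
    exact ⟨x, hx, rfl⟩
  obtain ⟨y, hy, hy2⟩ := half_mem_dist_approxSet hk
  have hhalf : (1 / 2 : ℝ) ∈ S := ⟨hr, y, hy, hy2.symm⟩
  obtain ⟨d, ⟨hrd, x, hx, hd⟩, hmax⟩ := Set.exists_max_image S id hS ⟨_, hhalf⟩
  have hd2 : 1 / 2 ≤ d := hmax _ hhalf
  have hpos : (0 : ℝ) < (2 : ℝ) ^ (-(k : ℤ)) := by positivity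
  refine ⟨d, ⟨⟨x, hx, hd⟩, by linarith, ?_⟩, hrd, ?_⟩
  · rw [hd, vertex_zero, dist_zero_right]
    exact norm_le_one_of_mem_iterate_hutchinson _ x hx
  · rw [discreteMeasure_apply k measurableSet_closedBall,
      discreteMeasure_apply k measurableSet_closedBall]
    refine measure_mono fun w hw => ?_
    simp only [Set.mem_preimage, Metric.mem_closedBall] at hw ⊢
    exact hmax _ ⟨hw, _, approxCode_mem _ w, rfl⟩

/-! ### Densities of the natural measure at `z₀` -/

theorem simDim_pos : 0 < simDim := div_pos (Real.log_pos (by norm_num)) (Real.log_pos (by norm_num))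

theorem two_rpow_simDim : (2 : ℝ) ^ simDim = 3 := by
  rw [Real.rpow_def_of_pos (by norm_num), simDim,
    mul_div_cancel₀ _ (Real.log_pos (by norm_num)).ne', Real.exp_log (by norm_num)]

theorem ofReal_rpow_mul_div_le (m : ℝ≥0∞) {t r d d' : ℝ} (ht : 0 ≤ t) (hr : 0 ≤ r) (hd : 0 < d)
    (h : r * d ≤ d') :
    ENNReal.ofReal (r ^ t) * (m / ENNReal.ofReal ((2 * d') ^ t))
      ≤ m / ENNReal.ofReal ((2 * d) ^ t) := by
  have hp : 0 < (2 * d) ^ t := Real.rpow_pos_of_pos (by linarith) _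
  rw [ENNReal.le_div_iff_mul_le (.inl (by simpa using hp)) (.inl ENNReal.ofReal_ne_top)]
  calc ENNReal.ofReal (r ^ t) * (m / ENNReal.ofReal ((2 * d') ^ t)) * ENNReal.ofReal ((2 * d) ^ t)
      = ENNReal.ofReal ((r * (2 * d)) ^ t) * (m / ENNReal.ofReal ((2 * d') ^ t)) := by
        rw [Real.mul_rpow hr (by linarith), ENNReal.ofReal_mul (by positivity)]
        ring
    _ ≤ ENNReal.ofReal ((2 * d') ^ t) * (m / ENNReal.ofReal ((2 * d') ^ t)) := by
        gcongr ENNReal.ofReal (?_ ^ t) * _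
        linarith
    _ ≤ m := ENNReal.mul_div_le

/-- The previous bound with ratio `r⁻¹` and the two radii exchanged. -/
theorem div_le_ofReal_rpow_mul (m : ℝ≥0∞) {t r d d' : ℝ} (ht : 0 ≤ t) (hr : 0 < r) (hd' : 0 < d')
    (h : d' ≤ r * d) :
    m / ENNReal.ofReal ((2 * d) ^ t)
      ≤ ENNReal.ofReal (r ^ t) * (m / ENNReal.ofReal ((2 * d') ^ t)) := by
  have h1 := ofReal_rpow_mul_div_le m ht (inv_nonneg.2 hr.le) hd'
    ((inv_mul_le_iff₀ hr).2 h)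
  calc m / ENNReal.ofReal ((2 * d) ^ t)
      = ENNReal.ofReal (r ^ t) *
        (ENNReal.ofReal (r⁻¹ ^ t) * (m / ENNReal.ofReal ((2 * d) ^ t))) := by
        rw [← mul_assoc, ← ENNReal.ofReal_mul (by positivity),
          ← Real.mul_rpow hr.le (by positivity), mul_inv_cancel₀ hr.ne']
        simp
    _ ≤ _ := by gcongr

theorem naturalMeasure_closedBall_eq (r : ℝ) :
    naturalMeasure (Metric.closedBall (vertex 0) r)
      = ∑ i : Fin 3, (3 : ℝ≥0∞)⁻¹ * codeMeasure {w | ‖sim i (code w)‖ ≤ r} := by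
  conv_lhs => rw [naturalMeasure_eq_map, map_codeMeasure_eq continuous_code.measurable]
  rw [Measure.finsetSum_apply]
  refine Finset.sum_congr rfl fun i _ => ?_
  have hm : Measurable fun w => code (cons i w) :=
    continuous_code.measurable.comp (measurable_cons i)
  rw [Measure.smul_apply, Measure.map_apply hm measurableSet_closedBall, smul_eq_mul]
  congr 2
  ext w
  simp [code_cons, vertex_zero]

theorem codeMeasure_norm_sim_zero_le (r : ℝ) :
    codeMeasure {w | ‖sim 0 (code w)‖ ≤ r}
      = naturalMeasure (Metric.closedBall (vertex 0) (2 * r)) := by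
  rw [naturalMeasure_apply measurableSet_closedBall]
  congr 1
  ext w
  simp only [sim, vertex_zero, smul_zero, add_zero, norm_smul, Set.mem_ofPred_eq,
    Set.mem_preimage, mem_closedBall_zero_iff, Real.norm_of_nonneg (by norm_num : (0 : ℝ) ≤ 1 / 2)]
  constructor <;> intro h <;> linarith

/-- Doubling the radius multiplies the denominator by `2^s = 3`, which is absorbed as the weight
`1/3` of one cell. -/
theorem density_two_mul {r : ℝ} (hr : 0 < r) :
    density naturalMeasure simDim (vertex 0) (2 * r)
      = (3 : ℝ≥0∞)⁻¹ * naturalMeasure (Metric.closedBall (vertex 0) (2 * r))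
        / ENNReal.ofReal ((2 * r) ^ simDim) := by
  have h3 : ENNReal.ofReal 3 = 3 := by simp
  rw [density, Real.mul_rpow (by norm_num) (by positivity : 0 ≤ 2 * r), two_rpow_simDim,
    ENNReal.ofReal_mul (by norm_num), h3, ENNReal.div_eq_inv_mul, ENNReal.div_eq_inv_mul,
    ENNReal.mul_inv (by simp) (by simp)]
  ring

theorem density_two_mul_le {r : ℝ} (hr : 0 < r) :
    density naturalMeasure simDim (vertex 0) (2 * r)
      ≤ density naturalMeasure simDim (vertex 0) r := by
  rw [density_two_mul hr, density, naturalMeasure_closedBall_eq r, ← codeMeasure_norm_sim_zero_le]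
  gcongr
  exact Finset.single_le_sum
    (f := fun i : Fin 3 => (3 : ℝ≥0∞)⁻¹ * codeMeasure {w | ‖sim i (code w)‖ ≤ r})
    (fun _ _ => zero_le) (Finset.mem_univ 0)

theorem density_two_mul_eq {r : ℝ} (hr : 0 < r) (hr2 : r < 1 / 2) :
    density naturalMeasure simDim (vertex 0) (2 * r)
      = density naturalMeasure simDim (vertex 0) r := by
  rw [density_two_mul hr, density, naturalMeasure_closedBall_eq r, ← codeMeasure_norm_sim_zero_le]
  congr 1
  symm
  refine Finset.sum_eq_single_of_mem 0 (Finset.mem_univ _) fun i _ hi => ?_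
  have : {w | ‖sim i (code w)‖ ≤ r} = ∅ := by
    ext w
    have := half_le_norm_sim_code hi w
    simp only [Set.mem_ofPred_eq, Set.mem_empty_iff_false, iff_false]
    linarith
  rw [this, measure_empty, mul_zero]

theorem tendsto_mul_half_pow {r : ℝ} (hr : 0 < r) :
    Tendsto (fun n : ℕ => r * (1 / 2 : ℝ) ^ n) atTop (𝓝[>] 0) := by
  refine tendsto_nhdsWithin_iff.2 ⟨?_, Eventually.of_forall fun n => ?_⟩
  · have := (tendsto_pow_atTop_nhds_zero_of_lt_one (r := (1 / 2 : ℝ))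
      (by norm_num) (by norm_num)).const_mul r
    simpa using this
  · exact Set.mem_Ioi.2 (by positivity)

/-- Along `r / 2^n → 0` the densities only increase. -/
theorem density_le_upperDensity {r : ℝ} (hr : 0 < r) :
    density naturalMeasure simDim (vertex 0) r
      ≤ upperDensity naturalMeasure simDim (vertex 0) := by
  have h : ∀ n : ℕ, density naturalMeasure simDim (vertex 0) r
      ≤ density naturalMeasure simDim (vertex 0) (r * (1 / 2 : ℝ) ^ n) := by
    intro n
    induction n with
    | zero => simp
    | succ n ih =>
      refine ih.trans ?_
      have := density_two_mul_le (r := r * (1 / 2 : ℝ) ^ (n + 1)) (by positivity)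
      rwa [show 2 * (r * (1 / 2 : ℝ) ^ (n + 1)) = r * (1 / 2 : ℝ) ^ n by rw [pow_succ]; ring]
        at this
  exact le_limsup_of_frequently_le
    ((tendsto_mul_half_pow hr).frequently (Frequently.of_forall h))

/-- Along `r / 2^n → 0` the density is constant, as each halved radius is below `1/2`. -/
theorem lowerDensity_le_density {r : ℝ} (hr : 0 < r) (hr1 : r < 1) :
    lowerDensity naturalMeasure simDim (vertex 0)
      ≤ density naturalMeasure simDim (vertex 0) r := by
  have h : ∀ n : ℕ, density naturalMeasure simDim (vertex 0) (r * (1 / 2 : ℝ) ^ n)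
      ≤ density naturalMeasure simDim (vertex 0) r := by
    intro n
    induction n with
    | zero => simp
    | succ n ih =>
      refine le_trans (le_of_eq ?_) ih
      have hlt : r * (1 / 2 : ℝ) ^ (n + 1) < 1 / 2 := by
        have : (1 / 2 : ℝ) ^ n ≤ 1 := pow_le_one₀ (by norm_num) (by norm_num)
        rw [pow_succ]
        nlinarith
      rw [← density_two_mul_eq (by positivity) hlt,
        show 2 * (r * (1 / 2 : ℝ) ^ (n + 1)) = r * (1 / 2 : ℝ) ^ n by rw [pow_succ]; ring]
  exact liminf_le_of_frequently_le
    ((tendsto_mul_half_pow hr).frequently (Frequently.of_forall h))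

/-- The lower density is dominated by the densities of open balls of radius at most `1`. -/
theorem lowerDensity_le_openDensity {r : ℝ} (hr : 0 < r) (hr1 : r ≤ 1) :
    lowerDensity naturalMeasure simDim (vertex 0)
      ≤ openDensity naturalMeasure simDim (vertex 0) r := by
  -- Approaching `r` from the left reaches `r = 1`. The numerator is frozen at the open ball, so
  -- only the denominator has to be continuous.
  have hc : Tendsto (fun d : ℝ => naturalMeasure (Metric.ball (vertex 0) r)
      / ENNReal.ofReal ((2 * d) ^ simDim)) (𝓝[<] r)
      (𝓝 (openDensity naturalMeasure simDim (vertex 0) r)) := by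
    refine Tendsto.mono_left ?_ nhdsWithin_le_nhds
    refine ENNReal.Tendsto.const_div (ENNReal.tendsto_ofReal ?_) (.inl ?_)
    · exact (tendsto_const_nhds.mul tendsto_id).rpow_const (.inr simDim_pos.le)
    · exact ENNReal.ofReal_ne_top
  refine ge_of_tendsto hc ?_
  filter_upwards [Ioo_mem_nhdsLT hr] with d hd
  refine (lowerDensity_le_density hd.1 (hd.2.trans_le hr1)).trans ?_
  unfold density
  gcongr
  exact Metric.closedBall_subset_ball hd.2

/-- Repeated doubling brings every radius of `(0, 1)` into `[1/2, 1)`. -/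
theorem forall_Ioo_of_forall_Ico_half {p : ℝ → Prop} (h : ∀ d, 1 / 2 ≤ d → d < 1 → p d)
    (hs : ∀ d, 0 < d → d < 1 / 2 → p (2 * d) → p d) {d : ℝ} (h0 : 0 < d) (h1 : d < 1) : p d := by
  have key : ∀ n : ℕ, ∀ d : ℝ, (1 / 2 : ℝ) ^ n ≤ d → d < 1 → p d := by
    intro n
    induction n with
    | zero =>
      intro d hd hd1
      rw [pow_zero] at hd
      exact absurd hd1 (not_lt.2 hd)
    | succ n ih =>
      intro d hd hd1
      have hpos : 0 < d := lt_of_lt_of_le (by positivity) hd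
      rcases le_or_gt (1 / 2) d with hd2 | hd2
      · exact h d hd2 hd1
      · refine hs d hpos hd2 (ih _ ?_ (by linarith))
        rw [pow_succ] at hd
        linarith
  obtain ⟨n, hn⟩ := exists_pow_lt_of_lt_one h0 (by norm_num : (1 / 2 : ℝ) < 1)
  exact key n d hn.le h1

theorem le_lowerDensity {c : ℝ≥0∞}
    (h : ∀ d, 1 / 2 ≤ d → d < 1 → c ≤ density naturalMeasure simDim (vertex 0) d) :
    c ≤ lowerDensity naturalMeasure simDim (vertex 0) := by
  refine le_liminf_of_le (by isBoundedDefault) ?_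
  filter_upwards [Ioo_mem_nhdsGT (zero_lt_one' ℝ)] with d hd
  exact forall_Ioo_of_forall_Ico_half h
    (fun d hd _ hc => hc.trans (density_two_mul_le hd)) hd.1 hd.2

theorem upperDensity_le {c : ℝ≥0∞}
    (h : ∀ d, 1 / 2 ≤ d → d < 1 → density naturalMeasure simDim (vertex 0) d ≤ c) :
    upperDensity naturalMeasure simDim (vertex 0) ≤ c := by
  refine limsup_le_of_le (by isBoundedDefault) ?_
  filter_upwards [Ioo_mem_nhdsGT (zero_lt_one' ℝ)] with d hd
  exact forall_Ioo_of_forall_Ico_half h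
    (fun d hd hd2 hc => (density_two_mul_eq hd hd2).symm.le.trans hc) hd.1 hd.2

/-! ### Bounds of the densities by the discrete estimates -/

theorem mul_lowerEstimate_le_lowerDensity {k : ℕ} (hk : 1 < k) :
    ENNReal.ofReal ((1 - (2 : ℝ) ^ (1 - (k : ℤ))) ^ simDim) * lowerEstimate k
      ≤ lowerDensity naturalMeasure simDim (vertex 0) := by
  have hk4 := two_zpow_neg_le hk
  have hpos : (0 : ℝ) < (2 : ℝ) ^ (-(k : ℤ)) := by positivity
  rw [two_zpow_one_sub]
  refine le_lowerDensity fun d hd hd1 => ?_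
  obtain ⟨d', hd', hlt, hle⟩ := exists_radius_ball_le (k := k)
    (r := d - (2 : ℝ) ^ (-(k : ℤ))) (by linarith) (by linarith)
  calc _ ≤ ENNReal.ofReal ((1 - 2 * (2 : ℝ) ^ (-(k : ℤ))) ^ simDim) *
        openDensity (discreteMeasure k) simDim (vertex 0) d' := by
        gcongr
        exact sInf_le ⟨d', hd', rfl⟩
    _ ≤ discreteMeasure k (Metric.ball (vertex 0) d') / ENNReal.ofReal ((2 * d) ^ simDim) :=
        -- From `d ≥ 1/2` follows `(1 - 2 * 2^{-k}) d ≤ d - 2^{-k} < d'`.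
        ofReal_rpow_mul_div_le _ simDim_pos.le (by linarith) (by linarith)
          (by nlinarith)
    _ ≤ density naturalMeasure simDim (vertex 0) d := by
        unfold density
        refine ENNReal.div_le_div_right ?_ _
        exact hle.trans (discreteMeasure_closedBall_sub_le hk.le _ _)

theorem upperDensity_le_mul_upperEstimate {k : ℕ} (hk : 1 < k) :
    upperDensity naturalMeasure simDim (vertex 0)
      ≤ ENNReal.ofReal ((1 + (2 : ℝ) ^ (1 - (k : ℤ))) ^ simDim) * upperEstimate k := by
  have hpos : (0 : ℝ) < (2 : ℝ) ^ (-(k : ℤ)) := by positivity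
  rw [two_zpow_one_sub]
  refine upperDensity_le fun d hd hd1 => ?_
  -- The enlarged radius may exceed `1`; the last radius below it is still at most `1`, since `A_k`
  -- lies in the unit ball.
  obtain ⟨d', hd', hlt, hle⟩ := exists_radius_closedBall_le hk
    (r := d + (2 : ℝ) ^ (-(k : ℤ))) (by linarith)
  calc density naturalMeasure simDim (vertex 0) d
      ≤ discreteMeasure k (Metric.closedBall (vertex 0) d')
        / ENNReal.ofReal ((2 * d) ^ simDim) := by
        unfold density
        refine ENNReal.div_le_div_right ?_ _
        exact (naturalMeasure_closedBall_le hk.le _ _).trans hle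
    _ ≤ ENNReal.ofReal ((1 + 2 * (2 : ℝ) ^ (-(k : ℤ))) ^ simDim) *
        density (discreteMeasure k) simDim (vertex 0) d' :=
        div_le_ofReal_rpow_mul _ simDim_pos.le (by linarith) (radii_pos hk hd')
          (by nlinarith)
    _ ≤ _ := by
        gcongr
        exact le_sSup ⟨d', hd', rfl⟩

end SierpinskiGasket

theorem theorem4p5 (k : ℕ) (hk : 1 < k) :
    -- the minimum and the maximum that define the two estimates are attained
    IsLeast (openDensity (discreteMeasure k)
        simDim (vertex 0) '' radii k)
      (lowerEstimate k) ∧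
    IsGreatest (density (discreteMeasure k)
        simDim (vertex 0) '' radii k)
      (upperEstimate k) ∧
    -- the lower density and its estimate, for every minimizing radius `d`
    (∀ d ∈ radii k,
      openDensity (discreteMeasure k)
        simDim (vertex 0) d = lowerEstimate k →
      ({lowerDensity naturalMeasure
          simDim (vertex 0),
        lowerEstimate k} : Set ℝ≥0∞) ⊆
      Set.Icc
        (ENNReal.ofReal ((1 - (2 : ℝ) ^ (1 - (k : ℤ))) ^ simDim) *
          lowerEstimate k)
        (discreteMeasure k
            (Metric.ball (vertex 0) (d + (2 : ℝ) ^ (-(k : ℤ)))) /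
          ENNReal.ofReal ((2 * d) ^ simDim))) ∧
    -- the upper density and its estimate, for every maximizing radius `D`
    (∀ D ∈ radii k,
      density (discreteMeasure k)
        simDim (vertex 0) D = upperEstimate k →
      ({upperDensity naturalMeasure
          simDim (vertex 0),
        upperEstimate k} : Set ℝ≥0∞) ⊆
      Set.Icc
        (discreteMeasure k
            (Metric.closedBall (vertex 0) (D - (2 : ℝ) ^ (-(k : ℤ)))) /
          ENNReal.ofReal ((2 * D) ^ simDim))
        (ENNReal.ofReal ((1 + (2 : ℝ) ^ (1 - (k : ℤ))) ^ simDim) *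
          upperEstimate k)) := by
  have hpos : (0 : ℝ) < (2 : ℝ) ^ (-(k : ℤ)) := by positivity
  have hk4 := two_zpow_neg_le hk
  refine ⟨?_, ?_, fun d hd hmin => ?_, fun D hD hmax => ?_⟩
  · exact ⟨Set.Nonempty.csInf_mem ((nonempty_radii hk).image _) ((finite_radii k).image _),
      fun _ h => sInf_le h⟩
  · exact ⟨Set.Nonempty.csSup_mem ((nonempty_radii hk).image _) ((finite_radii k).image _),
      fun _ h => le_sSup h⟩
  · have hd0 := radii_pos hk hd
    rintro _ (rfl | rfl)
    -- The minimizing radius may be `1`, so the open-ball bound is the one that applies.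
    · refine ⟨mul_lowerEstimate_le_lowerDensity hk,
        (lowerDensity_le_openDensity hd0 hd.2.2).trans ?_⟩
      unfold openDensity
      exact ENNReal.div_le_div_right (naturalMeasure_ball_le hk.le _ _) _
    · constructor
      · refine mul_le_of_le_one_left' (ENNReal.ofReal_le_one.2 ?_)
        rw [two_zpow_one_sub]
        exact Real.rpow_le_one (by linarith) (by linarith) simDim_pos.le
      · rw [← hmin, openDensity]
        gcongr
        linarith
  · have hD0 := radii_pos hk hD
    rintro _ (rfl | rfl)
    · refine ⟨le_trans ?_ (density_le_upperDensity hD0), upperDensity_le_mul_upperEstimate hk⟩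
      unfold density
      exact ENNReal.div_le_div_right (discreteMeasure_closedBall_sub_le hk.le _ _) _
    · constructor
      · rw [← hmax, density]
        gcongr
        linarith
      · refine le_mul_of_one_le_left' (ENNReal.one_le_ofReal.2 ?_)
        rw [two_zpow_one_sub]
        exact Real.one_le_rpow (by linarith) simDim_pos.le
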